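/- Let $P$ be a finite poset. A chain of $P$ with $k$ elements has length $k-1$, and $P$ is \emph{graded} if all its maximal chains have the same length. In a graded poset the \emph{rank} of an element $p$ is the largest length of a chain of $P$ whose greatest element is $p$. A graded poset is called \emph{maximal ranked} if any two elements of different rank are comparable. The \emph{order polytope} and the \emph{chain polytope} of $P$ are $$\mathcal O(P)=\{x\in\mathbb R^P : 0\le x_p\le 1 \text{ for all } p\in P,\ x_p\ge x_q \text{ whenever } p\le q \text{ in } P\},$$ $$\mathcal C(P)=\{x\in\mathbb R^P : x_p\ge 0 \text{ for all } p\in P,\ x_{p_1}+\cdots+x_{p_k}\le 1 \text{ whenever } p_1<\cdots<p_k \text{ in } P\}.$$ A \emph{triangular $2$-face} of a polytope is a two-dimensional face that is the convex hull of three points. If $P$ is a maximal ranked poset, then the number of triangular $2$-faces of $\mathcal O(P)$ is less than or equal to the number of triangular $2$-faces of $\mathcal C(P)$ (both numbers being finite). -/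

import Mathlib

/-- The order polytope of `P`, in the coordinate space `ℝ^P`. -/
def orderPolytope (P : Type*) [PartialOrder P] : Set (P → ℝ) :=
  {x | (∀ p, 0 ≤ x p ∧ x p ≤ 1) ∧ ∀ p q : P, p ≤ q → x q ≤ x p}

/-- The chain polytope of `P`, in the coordinate space `ℝ^P`: coordinates are nonnegative, and
their sum along every (finite) chain is at most `1`. -/
def chainPolytope (P : Type*) [PartialOrder P] : Set (P → ℝ) :=
  {x | (∀ p, 0 ≤ x p) ∧
    ∀ c : Finset P, IsChain (· ≤ ·) (c : Set P) → ∑ p ∈ c, x p ≤ 1}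

/-- `F` is a two-dimensional face of the polytope `Q`: a nonempty set of the form
`{x ∈ Q | ∀ y ∈ Q, l y ≤ l x}` for a linear functional `l`, of affine dimension `2`. -/
structure IsTwoFace {P : Type*} (Q F : Set (P → ℝ)) : Prop where
  nonempty : F.Nonempty
  isExposed : IsExposed ℝ Q F
  finrank_eq : Module.finrank ℝ (vectorSpan ℝ F) = 2

/-- The set of triangular two-dimensional faces of `Q`: those that are the convex hull of three
points (which are affinely independent, since the hull has dimension `2`). -/
def triangularTwoFaces {P : Type*} (Q : Set (P → ℝ)) : Set (Set (P → ℝ)) :=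
  {F | IsTwoFace Q F ∧ ∃ a b c : P → ℝ, F = convexHull ℝ {a, b, c}}

/-- `P` is graded of rank `n`: every maximal chain has length `n`, where the length of a chain is
its number of elements minus one (as an integer, so that the empty poset has rank `-1`). -/
def IsGradedOfRank (P : Type*) [PartialOrder P] (n : ℤ) : Prop :=
  ∀ c : Set P, IsMaxChain (· ≤ ·) c → (c.ncard : ℤ) - 1 = n

/-- A maximal ranked poset: a graded poset in which any two elements of distinct rank are
comparable. The rank of an element of a graded poset is its height, the largest length of a chain
with that element at its top. -/
structure IsMaximalRanked (P : Type*) [PartialOrder P] : Prop where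
  graded : ∃ n : ℤ, IsGradedOfRank P n
  comparable : ∀ p q : P, Order.height p ≠ Order.height q → p ≤ q ∨ q ≤ p

open Set Module

/-! In a maximal ranked poset `p < q` holds exactly when `p` has smaller height, so `P` is an
ordinal sum of antichains, its layers. The triangles of the order polytope are injected into those
of the chain polytope.

The vertices of a triangle of the order polytope are three lower sets. Trading elements between two
of them keeps their midpoint, so both new lower sets must again be among the three. This forces a
flag `I ⊂ J ⊂ K` whose three differences are each a singleton or meet two layers
(`exists_isLowerTriple_of_mem_triangularTwoFaces`).

A lower set is determined by its top layer, and also by the bottom layer of its complement. The flag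
is sent to antichains `R`, `X`, `S`: the bottom layer of `Iᶜ`, the set `midLayer h I J K`, the top
layer of `K`. Here `X` is the top layer of `J` when that lies above `R`, and otherwise a substitute
from which `J` can still be read off (`IsLowerTriple.midLayer_spec`). Such triples span triangles of
the chain polytope (`IsAntichainTriple.convexHull_mem`), and the triangle determines the ordered
triple (`IsAntichainTriple.eq_of_set_eq`). -/

/-- The `0/1`-vector of a finite set. -/
noncomputable def charVec {P : Type*} [DecidableEq P] (A : Finset P) : P → ℝ :=
  fun p => if p ∈ A then 1 else 0

/-! ### 0/1-vectors as vertices of the cube -/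

section CharVec

variable {P : Type*} [DecidableEq P]

theorem charVec_apply_of_mem {A : Finset P} {p : P} (h : p ∈ A) : charVec A p = 1 := by
  simp [charVec, h]

theorem charVec_apply_of_notMem {A : Finset P} {p : P} (h : p ∉ A) : charVec A p = 0 := by
  simp [charVec, h]

theorem charVec_nonneg (A : Finset P) (p : P) : 0 ≤ charVec A p := by
  unfold charVec; split_ifs <;> norm_num

theorem charVec_le_one (A : Finset P) (p : P) : charVec A p ≤ 1 := by
  unfold charVec; split_ifs <;> norm_num

theorem charVec_injective : Function.Injective (charVec (P := P)) := by
  intro A B h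
  ext p
  have := congrFun h p
  by_cases hA : p ∈ A <;> by_cases hB : p ∈ B <;> simp_all [charVec]

theorem eq_zero_or_one_charVec (A : Finset P) (p : P) : charVec A p = 0 ∨ charVec A p = 1 := by
  unfold charVec; split_ifs <;> simp

theorem charVec_mem_extremePoints_cube (A : Finset P) :
    charVec A ∈ (univ.pi fun _ : P => Icc (0 : ℝ) 1).extremePoints ℝ := by
  rw [extremePoints_pi]
  intro p _
  rw [Set.extremePoints_Icc zero_le_one]
  exact eq_zero_or_one_charVec A p

/-- A 0/1-vector is a vertex of the unit cube, hence extreme in any subset of the cube containing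
it, and extreme points of a hull are among its generators. -/
theorem mem_of_charVec_mem_convexHull {T : Set (Finset P)} {A : Finset P}
    (h : charVec A ∈ convexHull ℝ (charVec '' T)) : A ∈ T := by
  have hsub : convexHull ℝ (charVec '' T) ⊆ univ.pi fun _ : P => Icc (0 : ℝ) 1 := by
    refine convexHull_min ?_ (convex_pi fun _ _ => convex_Icc 0 1)
    rintro _ ⟨B, -, rfl⟩ p -
    exact ⟨charVec_nonneg B p, charVec_le_one B p⟩
  have hext := inter_extremePoints_subset_extremePoints_of_subset (𝕜 := ℝ) hsub
    ⟨h, charVec_mem_extremePoints_cube A⟩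
  obtain ⟨B, hB, hBA⟩ := extremePoints_convexHull_subset hext
  exact charVec_injective hBA ▸ hB

theorem convexHull_charVec_injective :
    Function.Injective fun T : Set (Finset P) => convexHull ℝ (charVec '' T) := by
  intro T T' h
  change convexHull ℝ _ = convexHull ℝ _ at h
  refine Subset.antisymm ?_ ?_ <;> intro A hA <;> refine mem_of_charVec_mem_convexHull ?_
  · exact h ▸ subset_convexHull ℝ _ (mem_image_of_mem _ hA)
  · exact h ▸ subset_convexHull ℝ _ (mem_image_of_mem _ hA)

theorem not_wbtw_charVec {A B C : Finset P} (hAB : A ≠ B) (hBC : B ≠ C) :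
    ¬ Wbtw ℝ (charVec A) (charVec B) (charVec C) := by
  intro h
  have hseg : charVec B ∈ convexHull ℝ (charVec '' {A, C}) := by
    rw [image_pair, convexHull_pair]
    exact mem_segment_iff_wbtw.2 h
  rcases mem_of_charVec_mem_convexHull hseg with h | h
  · exact hAB h.symm
  · exact hBC h

theorem finrank_vectorSpan_charVec {A B C : Finset P} (hAB : A ≠ B) (hAC : A ≠ C) (hBC : B ≠ C) :
    finrank ℝ (vectorSpan ℝ (convexHull ℝ {charVec A, charVec B, charVec C})) = 2 := by
  have hind : AffineIndependent ℝ ![charVec A, charVec B, charVec C] := by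
    rw [affineIndependent_iff_not_collinear_set]
    intro hcol
    rcases hcol.wbtw_or_wbtw_or_wbtw with h | h | h
    · exact not_wbtw_charVec hAB hBC h
    · exact not_wbtw_charVec hBC hAC.symm h
    · exact not_wbtw_charVec hAC.symm hAB h
  have := hind.finrank_vectorSpan (n := 2) (by simp)
  have hrange : range ![charVec A, charVec B, charVec C] = {charVec A, charVec B, charVec C} := by
    ext x
    simp only [mem_range, Fin.exists_fin_succ, mem_insert_iff, mem_singleton_iff]
    simp [eq_comm]
  rwa [hrange, ← direction_affineSpan, ← affineSpan_convexHull, direction_affineSpan] at this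

end CharVec

/-! ### Triangular faces, exposed faces, finiteness -/

section Faces

variable {P : Type*} {Q F : Set (P → ℝ)}

theorem convexHull_extremePoints_of_mem_triangularTwoFaces (hF : F ∈ triangularTwoFaces Q) :
    convexHull ℝ (F.extremePoints ℝ) = F := by
  obtain ⟨-, a, b, c, habc⟩ := hF
  have hfin : ({a, b, c} : Set (P → ℝ)).Finite := toFinite _
  have hsub : F.extremePoints ℝ ⊆ {a, b, c} := habc ▸ extremePoints_convexHull_subset
  have hcomp : IsCompact F := habc ▸ hfin.isCompact_convexHull ℝ
  have hconv : Convex ℝ F := habc ▸ convex_convexHull ℝ _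
  have := closure_convexHull_extremePoints hcomp hconv
  rwa [((hfin.subset hsub).isClosed_convexHull ℝ).closure_eq] at this

theorem exists_extremePoints_eq_of_mem_triangularTwoFaces (hF : F ∈ triangularTwoFaces Q) :
    ∃ a b c, a ≠ b ∧ a ≠ c ∧ b ≠ c ∧ F.extremePoints ℝ = {a, b, c} := by
  have hhull := convexHull_extremePoints_of_mem_triangularTwoFaces hF
  obtain ⟨⟨hne, -, hdim⟩, a, b, c, habc⟩ := hF
  have hsub : F.extremePoints ℝ ⊆ {a, b, c} := habc ▸ extremePoints_convexHull_subset
  have hfin : (F.extremePoints ℝ).Finite := (toFinite _).subset hsub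
  have hle : (F.extremePoints ℝ).ncard ≤ 3 :=
    (ncard_le_ncard hsub (toFinite _)).trans ((ncard_insert_le _ _).trans
      (Nat.succ_le_succ ((ncard_insert_le _ _).trans (by simp))))
  have hge : 3 ≤ (F.extremePoints ℝ).ncard := by
    rw [← hhull, ← direction_affineSpan, affineSpan_convexHull, direction_affineSpan] at hdim
    have : Nonempty (F.extremePoints ℝ) := by
      rw [nonempty_coe_sort, nonempty_iff_ne_empty]
      intro h
      simp [h] at hhull
      exact hne.ne_empty hhull.symm
    have := hfin.fintype
    have h := finrank_vectorSpan_range_add_one_le ℝ (Subtype.val : F.extremePoints ℝ → P → ℝ)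
    rw [Subtype.range_coe, hdim, ← Nat.card_eq_fintype_card, Nat.card_coe_set_eq] at h
    exact h
  exact ncard_eq_three.1 (hle.antisymm hge)

theorem finite_triangularTwoFaces (hQ : (Q.extremePoints ℝ).Finite) :
    (triangularTwoFaces Q).Finite := by
  refine (hQ.finite_subsets.image (convexHull ℝ)).subset fun F hF => ?_
  exact ⟨F.extremePoints ℝ, hF.1.isExposed.isExtreme.extremePoints_subset_extremePoints,
    convexHull_extremePoints_of_mem_triangularTwoFaces hF⟩

/-- The set where finitely many valid inequalities are tight is an exposed face. -/
theorem isExposed_setOf_forall_eq [Fintype P] {ι : Type*} [Finite ι]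
    (l : ι → (P → ℝ) →ₗ[ℝ] ℝ) (b : ι → ℝ) (hl : ∀ i, ∀ x ∈ Q, l i x ≤ b i) :
    IsExposed ℝ Q {x ∈ Q | ∀ i, l i x = b i} := by
  have := Fintype.ofFinite ι
  rintro ⟨w, hwQ, hw⟩
  refine ⟨LinearMap.toContinuousLinearMap (∑ i, l i), Subset.antisymm ?_ ?_⟩
  · rintro x ⟨hxQ, hx⟩
    refine ⟨hxQ, fun y hy => ?_⟩
    simpa [hx] using Finset.sum_le_sum fun i _ => hl i y hy
  · rintro x ⟨hxQ, hx⟩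
    refine ⟨hxQ, fun i => ?_⟩
    -- The summed functional attains the sum of the bounds at `w`, so a maximizer must make every
    -- single inequality tight.
    have h1 : ∑ i, b i ≤ ∑ i, l i x := by simpa [hw] using hx w hwQ
    exact (Finset.sum_eq_sum_iff_of_le fun i _ => hl i x hxQ).1
      ((Finset.sum_le_sum fun i _ => hl i x hxQ).antisymm h1) i (Finset.mem_univ i)

/-- An extreme point is determined by its set of tight inequalities: if `x ≠ y` had the same set,
the segment from `y` to `x` could be prolonged slightly beyond `x`. -/
theorem finite_extremePoints_setOf_forall_le {ι : Type*} [Finite ι]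
    (l : ι → (P → ℝ) →ₗ[ℝ] ℝ) (b : ι → ℝ) :
    ({x | ∀ i, l i x ≤ b i}.extremePoints ℝ).Finite := by
  refine Finite.of_injOn (f := fun x => {i | l i x = b i}) (t := univ) (fun _ _ => mem_univ _)
    ?_ finite_univ
  intro x hx y hy hxy
  by_contra hne
  have hev : ∀ᶠ ε : ℝ in nhdsWithin 0 (Ioi 0), ∀ i, l i x + ε * (l i x - l i y) ≤ b i := by
    rw [Filter.eventually_all]
    intro i
    rcases (hx.1 i).eq_or_lt with h | h
    · have h' : l i y = b i := by
        have : i ∈ {i | l i y = b i} := (Set.ext_iff.1 hxy i).1 h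
        exact this
      simp [h, h']
    · have hc : Filter.Tendsto (fun ε : ℝ => l i x + ε * (l i x - l i y)) (nhds 0)
          (nhds (l i x + 0 * (l i x - l i y))) :=
        (Continuous.tendsto (by fun_prop) _)
      rw [zero_mul, add_zero] at hc
      exact ((hc.eventually (gt_mem_nhds h)).filter_mono nhdsWithin_le_nhds).mono fun _ h => h.le
  obtain ⟨ε, hε, hε0⟩ := (hev.and self_mem_nhdsWithin).exists
  have hε0 : 0 < ε := hε0
  have hz : x + ε • (x - y) ∈ {x | ∀ i, l i x ≤ b i} := by
    intro i
    simpa using hε i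
  refine hne (hx.2 hy.1 hz ⟨ε / (1 + ε), 1 / (1 + ε), by positivity, by positivity, ?_, ?_⟩).symm
  · field_simp; ring
  · ext p
    simp
    field_simp
    ring

end Faces

/-! ### Triangles of the chain polytope -/

section ChainPolytope

variable {P : Type*} [PartialOrder P]

/-- The left-hand sides of the defining inequalities of the chain polytope. -/
noncomputable def chainForm :
    P ⊕ {c : Finset P // IsChain (· ≤ ·) (c : Set P)} → (P → ℝ) →ₗ[ℝ] ℝ :=
  Sum.elim (fun p => -LinearMap.proj p) (fun c => ∑ p ∈ c.1, LinearMap.proj p)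

/-- The right-hand sides of the defining inequalities of the chain polytope. -/
def chainBound : P ⊕ {c : Finset P // IsChain (· ≤ ·) (c : Set P)} → ℝ :=
  Sum.elim (fun _ => 0) (fun _ => 1)

theorem chainPolytope_eq_setOf :
    chainPolytope P = {x | ∀ i, chainForm i x ≤ chainBound i} := by
  ext x
  simp [chainPolytope, chainForm, chainBound]

theorem finite_triangularTwoFaces_chainPolytope [Finite P] :
    (triangularTwoFaces (chainPolytope P)).Finite := by
  refine finite_triangularTwoFaces ?_
  rw [chainPolytope_eq_setOf]
  exact finite_extremePoints_setOf_forall_le _ _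

theorem convex_chainPolytope : Convex ℝ (chainPolytope P) := by
  rw [chainPolytope_eq_setOf, ofPred_forall]
  exact convex_iInter fun i => convex_halfSpace_le (chainForm i).isLinear _

theorem isExposed_chainPolytope [Fintype P] (U : Set P) (𝒞 : Set (Finset P))
    (h𝒞 : ∀ c ∈ 𝒞, IsChain (· ≤ ·) (c : Set P)) :
    IsExposed ℝ (chainPolytope P)
      {x ∈ chainPolytope P | (∀ p ∉ U, x p = 0) ∧ ∀ c ∈ 𝒞, ∑ p ∈ c, x p = 1} := by
  have := isExposed_setOf_forall_eq (Q := chainPolytope P)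
    (ι := {p // p ∉ U} ⊕ {c // c ∈ 𝒞})
    (fun i => chainForm (i.map Subtype.val fun c => ⟨c.1, h𝒞 c.1 c.2⟩))
    (fun i => chainBound (i.map Subtype.val fun c => ⟨c.1, h𝒞 c.1 c.2⟩))
    (fun i x hx => by
      rw [chainPolytope_eq_setOf] at hx
      exact hx _)
  convert this using 4
  simp [chainForm, chainBound]

variable [DecidableEq P]

theorem charVec_mem_chainPolytope {A : Finset P} (hA : IsAntichain (· ≤ ·) (A : Set P)) :
    charVec A ∈ chainPolytope P := by
  refine ⟨charVec_nonneg A, fun c hc => ?_⟩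
  have : (c.filter (· ∈ A)).card ≤ 1 := by
    rw [Finset.card_le_one]
    intro p hp q hq
    simp only [Finset.mem_filter] at hp hq
    by_contra hne
    rcases hc hp.1 hq.1 hne with h | h
    · exact hA hp.2 hq.2 hne h
    · exact hA hq.2 hp.2 (Ne.symm hne) h
  simp only [charVec, Finset.sum_boole]
  exact_mod_cast this

/-- The candidate face is cut out by vanishing off `A ∪ B ∪ C` and tightness on the chains of `𝒞`;
`hcomb` says it contains nothing outside the triangle. -/
theorem convexHull_charVec_mem_triangularTwoFaces [Fintype P] {A B C : Finset P}
    (hA : IsAntichain (· ≤ ·) (A : Set P)) (hB : IsAntichain (· ≤ ·) (B : Set P))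
    (hC : IsAntichain (· ≤ ·) (C : Set P)) (hAB : A ≠ B) (hAC : A ≠ C) (hBC : B ≠ C)
    (𝒞 : Set (Finset P)) (h𝒞 : ∀ c ∈ 𝒞, IsChain (· ≤ ·) (c : Set P))
    (h𝒞A : ∀ c ∈ 𝒞, ∑ p ∈ c, charVec A p = 1) (h𝒞B : ∀ c ∈ 𝒞, ∑ p ∈ c, charVec B p = 1)
    (h𝒞C : ∀ c ∈ 𝒞, ∑ p ∈ c, charVec C p = 1)
    (hcomb : ∀ x ∈ chainPolytope P, (∀ p ∉ A ∪ B ∪ C, x p = 0) →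
      (∀ c ∈ 𝒞, ∑ p ∈ c, x p = 1) → ∃ a b c : ℝ, 0 ≤ a ∧ 0 ≤ b ∧ 0 ≤ c ∧ a + b + c = 1 ∧
        ∀ p, x p = a * charVec A p + b * charVec B p + c * charVec C p) :
    convexHull ℝ (charVec '' {A, B, C}) ∈ triangularTwoFaces (chainPolytope P) := by
  have himage : charVec '' {A, B, C} = {charVec A, charVec B, charVec C} := by
    rw [image_insert_eq, image_pair]
  have hexp := isExposed_chainPolytope ((A ∪ B ∪ C : Finset P) : Set P) 𝒞 h𝒞
  have heq : convexHull ℝ (charVec '' {A, B, C}) = {x ∈ chainPolytope P |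
      (∀ p ∉ ((A ∪ B ∪ C : Finset P) : Set P), x p = 0) ∧ ∀ c ∈ 𝒞, ∑ p ∈ c, x p = 1} := by
    refine Subset.antisymm (convexHull_min ?_ (hexp.convex convex_chainPolytope)) ?_
    · rintro _ ⟨D, rfl | rfl | rfl, rfl⟩
      · exact ⟨charVec_mem_chainPolytope hA, fun p hp => charVec_apply_of_notMem (by aesop), h𝒞A⟩
      · exact ⟨charVec_mem_chainPolytope hB, fun p hp => charVec_apply_of_notMem (by aesop), h𝒞B⟩
      · exact ⟨charVec_mem_chainPolytope hC, fun p hp => charVec_apply_of_notMem (by aesop), h𝒞C⟩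
    · rintro x ⟨hx, hxU, hx𝒞⟩
      obtain ⟨a, b, c, ha, hb, hc, habc, hxabc⟩ := hcomb x hx (fun p hp => hxU p hp) hx𝒞
      have hmem : ∀ D ∈ ({A, B, C} : Set (Finset P)),
          charVec D ∈ convexHull ℝ (charVec '' {A, B, C}) := fun D hD =>
        subset_convexHull ℝ _ (mem_image_of_mem _ hD)
      have := (convex_convexHull ℝ (charVec '' {A, B, C})).sum_mem (t := Finset.univ)
        (w := ![a, b, c]) (z := ![charVec A, charVec B, charVec C])
        (by simp [Fin.forall_fin_succ, ha, hb, hc]) (by simp [Fin.sum_univ_three, habc])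
        (by simp [Fin.forall_fin_succ, hmem])
      convert this using 1
      ext p
      simp [Fin.sum_univ_three, hxabc]
  refine ⟨⟨?_, heq ▸ hexp, ?_⟩, charVec A, charVec B, charVec C, by rw [himage]⟩
  · exact ⟨charVec A, subset_convexHull ℝ _ (mem_image_of_mem _ (by simp))⟩
  · rw [himage]
    exact finrank_vectorSpan_charVec hAB hAC hBC

theorem isChain_coe_pair {p q : P} (hpq : p ≤ q) :
    IsChain (· ≤ ·) ((({p, q} : Finset P)) : Set P) := by
  rw [Finset.coe_pair]
  exact IsChain.pair hpq

/-- Tightness on every chain `{r, x, s}` forces a point to be constant on each of `R`, `X`, `S`. -/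
theorem triangularTwoFaces_of_three_layers [Fintype P] {R X S : Finset P}
    (hRa : IsAntichain (· ≤ ·) (R : Set P)) (hXa : IsAntichain (· ≤ ·) (X : Set P))
    (hSa : IsAntichain (· ≤ ·) (S : Set P)) (hR : R.Nonempty) (hX : X.Nonempty) (hS : S.Nonempty)
    (hRX : ∀ r ∈ R, ∀ x ∈ X, r < x) (hXS : ∀ x ∈ X, ∀ s ∈ S, x < s) :
    convexHull ℝ (charVec '' {R, X, S}) ∈ triangularTwoFaces (chainPolytope P) := by
  obtain ⟨r₀, hr₀⟩ := hR
  obtain ⟨x₀, hx₀⟩ := hX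
  obtain ⟨s₀, hs₀⟩ := hS
  have hRS : ∀ r ∈ R, ∀ s ∈ S, r < s := fun r hr s hs => (hRX r hr x₀ hx₀).trans (hXS x₀ hx₀ s hs)
  have dRX : ∀ p ∈ R, p ∉ X := fun p hp hp' => lt_irrefl _ (hRX p hp p hp')
  have dXS : ∀ p ∈ X, p ∉ S := fun p hp hp' => lt_irrefl _ (hXS p hp p hp')
  have dRS : ∀ p ∈ R, p ∉ S := fun p hp hp' => lt_irrefl _ (hRS p hp p hp')
  have dXR : ∀ p ∈ X, p ∉ R := fun p hp hp' => dRX p hp' hp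
  have dSX : ∀ p ∈ S, p ∉ X := fun p hp hp' => dXS p hp' hp
  have dSR : ∀ p ∈ S, p ∉ R := fun p hp hp' => dRS p hp' hp
  have hsum : ∀ f : P → ℝ, ∀ r ∈ R, ∀ x ∈ X, ∀ s ∈ S,
      ∑ p ∈ {r, x, s}, f p = f r + f x + f s := by
    intro f r hr x hx s hs
    rw [Finset.sum_insert, Finset.sum_pair (hXS x hx s hs).ne, add_assoc]
    simp [(hRX r hr x hx).ne, (hRS r hr s hs).ne]
  refine convexHull_charVec_mem_triangularTwoFaces hRa hXa hSa
    (fun h => dRX r₀ hr₀ (h ▸ hr₀)) (fun h => dRS r₀ hr₀ (h ▸ hr₀)) (fun h => dXS x₀ hx₀ (h ▸ hx₀))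
    {c | ∃ r ∈ R, ∃ x ∈ X, ∃ s ∈ S, c = {r, x, s}} ?_ ?_ ?_ ?_ ?_
  · rintro c ⟨r, hr, x, hx, s, hs, rfl⟩
    rw [Finset.coe_insert]
    refine (isChain_coe_pair (hXS x hx s hs).le).insert ?_
    intro b hb _
    simp only [Finset.coe_pair, mem_insert_iff, mem_singleton_iff] at hb
    rcases hb with rfl | rfl
    · exact Or.inl (hRX r hr _ hx).le
    · exact Or.inl (hRS r hr _ hs).le
  · rintro c ⟨r, hr, x, hx, s, hs, rfl⟩
    simp [hsum _ r hr x hx s hs, charVec, hr, dXR x hx, dSR s hs]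
  · rintro c ⟨r, hr, x, hx, s, hs, rfl⟩
    simp [hsum _ r hr x hx s hs, charVec, hx, dRX r hr, dSX s hs]
  · rintro c ⟨r, hr, x, hx, s, hs, rfl⟩
    simp [hsum _ r hr x hx s hs, charVec, hs, dRS r hr, dXS x hx]
  · intro y hy hyU hyc
    have hy3 : ∀ r ∈ R, ∀ x ∈ X, ∀ s ∈ S, y r + y x + y s = 1 := fun r hr x hx s hs =>
      hsum y r hr x hx s hs ▸ hyc _ ⟨r, hr, x, hx, s, hs, rfl⟩
    refine ⟨y r₀, y x₀, y s₀, hy.1 _, hy.1 _, hy.1 _, hy3 _ hr₀ _ hx₀ _ hs₀, fun p => ?_⟩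
    have h0 := hy3 _ hr₀ _ hx₀ _ hs₀
    by_cases hpR : p ∈ R
    · have := hy3 p hpR _ hx₀ _ hs₀
      simp only [charVec, hpR, dRX p hpR, dRS p hpR, if_true, if_false]
      linarith
    by_cases hpX : p ∈ X
    · have := hy3 _ hr₀ p hpX _ hs₀
      simp only [charVec, hpR, hpX, dXS p hpX, if_true, if_false]
      linarith
    by_cases hpS : p ∈ S
    · have := hy3 _ hr₀ _ hx₀ p hpS
      simp only [charVec, hpR, hpX, hpS, if_true, if_false]
      linarith
    · simp [charVec, hpR, hpX, hpS, hyU]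

/-- Tightness on the chains `{x, z}` makes a point constant on `X` and on `Z`; only the coordinate
at `p` stays free, between `0` and the value on `X`. -/
theorem triangularTwoFaces_of_two_layers [Fintype P] {X Z : Finset P} {p : P} (hp : p ∉ X)
    (hYa : IsAntichain (· ≤ ·) ((insert p X : Finset P) : Set P))
    (hZa : IsAntichain (· ≤ ·) (Z : Set P)) (hX : X.Nonempty) (hZ : Z.Nonempty)
    (hYZ : ∀ y ∈ insert p X, ∀ z ∈ Z, y < z ∨ z < y) :
    convexHull ℝ (charVec '' {X, insert p X, Z}) ∈ triangularTwoFaces (chainPolytope P) := by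
  obtain ⟨x₀, hx₀⟩ := hX
  obtain ⟨z₀, hz₀⟩ := hZ
  have hXY : X ⊆ insert p X := Finset.subset_insert p X
  have hXa : IsAntichain (· ≤ ·) (X : Set P) := hYa.subset (by exact_mod_cast hXY)
  have hne : ∀ y ∈ insert p X, ∀ z ∈ Z, y ≠ z := by
    rintro y hy _ hz rfl
    simpa using hYZ y hy y hz
  have dYZ : ∀ q ∈ insert p X, q ∉ Z := fun q hq hq' => hne q hq q hq' rfl
  have dXZ : ∀ q ∈ X, q ∉ Z := fun q hq => dYZ q (hXY hq)
  have dZX : ∀ q ∈ Z, q ∉ X := fun q hq hq' => dXZ q hq' hq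
  have dpZ : p ∉ Z := dYZ p (Finset.mem_insert_self _ _)
  have hchain : ∀ y ∈ insert p X, ∀ z ∈ Z, IsChain (· ≤ ·) ((({y, z} : Finset P)) : Set P) := by
    intro y hy z hz
    rcases hYZ y hy z hz with h | h
    · exact isChain_coe_pair h.le
    · rw [Finset.pair_comm]
      exact isChain_coe_pair h.le
  refine convexHull_charVec_mem_triangularTwoFaces hXa hYa hZa
    (fun h => hp (h ▸ Finset.mem_insert_self p X)) (fun h => dXZ x₀ hx₀ (h ▸ hx₀))
    (fun h => dpZ (h ▸ Finset.mem_insert_self p X))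
    {c | ∃ x ∈ X, ∃ z ∈ Z, c = {x, z}} ?_ ?_ ?_ ?_ ?_
  · rintro c ⟨x, hx, z, hz, rfl⟩
    exact hchain x (hXY hx) z hz
  · rintro c ⟨x, hx, z, hz, rfl⟩
    simp [Finset.sum_pair (hne x (hXY hx) z hz), charVec, hx, dZX z hz]
  · rintro c ⟨x, hx, z, hz, rfl⟩
    have : z ∉ insert p X := fun h => dYZ z h hz
    simp only [Finset.sum_pair (hne x (hXY hx) z hz), charVec, hXY hx, this]
    simp
  · rintro c ⟨x, hx, z, hz, rfl⟩
    simp [Finset.sum_pair (hne x (hXY hx) z hz), charVec, hz, dXZ x hx]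
  · intro y hy hyU hyc
    have hy2 : ∀ x ∈ X, ∀ z ∈ Z, y x + y z = 1 := fun x hx z hz =>
      Finset.sum_pair (hne x (hXY hx) z hz) (f := y) ▸ hyc _ ⟨x, hx, z, hz, rfl⟩
    have hpz := hy.2 _ (hchain p (Finset.mem_insert_self _ _) z₀ hz₀)
    rw [Finset.sum_pair (hne p (Finset.mem_insert_self _ _) z₀ hz₀)] at hpz
    have h0 := hy2 _ hx₀ _ hz₀
    -- Only `insert p X` contains `p`, so its weight is `y p`; the chain `{p, z₀}` against the tight
    -- `{x₀, z₀}` gives `y p ≤ y x₀`.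
    refine ⟨y x₀ - y p, y p, y z₀, by linarith, hy.1 _, hy.1 _, by linarith, fun q => ?_⟩
    by_cases hqX : q ∈ X
    · have := hy2 q hqX _ hz₀
      simp only [charVec, hqX, hXY hqX, dXZ q hqX, if_true, if_false]
      linarith
    by_cases hqp : q = p
    · subst hqp
      simp [charVec, hp, dpZ]
    by_cases hqZ : q ∈ Z
    · have := hy2 _ hx₀ q hqZ
      simp only [charVec, hqX, hqZ, Finset.mem_insert, hqp, or_self, if_true, if_false]
      linarith
    · simp [charVec, hqX, hqp, hqZ, hyU]

theorem triangularTwoFaces_of_lt [Fintype P] {p q : P} (hpq : p < q) :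
    convexHull ℝ (charVec '' {{p}, ∅, {q}}) ∈ triangularTwoFaces (chainPolytope P) := by
  refine convexHull_charVec_mem_triangularTwoFaces (by simp) (by simp) (by simp) (by simp)
    (by simpa using hpq.ne) (by simp) ∅ (by simp) (by simp) (by simp) (by simp) ?_
  intro y hy hyU _
  have h := hy.2 _ (isChain_coe_pair hpq.le)
  rw [Finset.sum_pair hpq.ne] at h
  refine ⟨y p, 1 - y p - y q, y q, hy.1 _, by linarith, hy.1 _, by ring, fun r => ?_⟩
  by_cases hrp : r = p
  · subst hrp
    simp [charVec, hpq.ne]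
  by_cases hrq : r = q
  · subst hrq
    simp [charVec, hrp]
  · simp [charVec, hrp, hrq, hyU]

end ChainPolytope

/-! ### Triangles of the order polytope as flags of lower sets -/

section OrderPolytope

variable {P : Type*} [PartialOrder P] [DecidableEq P]

theorem charVec_mem_orderPolytope_iff {A : Finset P} :
    charVec A ∈ orderPolytope P ↔ IsLowerSet (A : Set P) := by
  constructor
  · intro h p q hqp hp
    by_contra hq
    have := h.2 q p hqp
    rw [charVec_apply_of_mem (by simpa using hp), charVec_apply_of_notMem (by simpa using hq)]
      at this
    linarith
  · intro h
    refine ⟨fun p => ⟨charVec_nonneg A p, charVec_le_one A p⟩, fun p q hpq => ?_⟩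
    by_cases hq : q ∈ A
    · rw [charVec_apply_of_mem hq, charVec_apply_of_mem (h hpq hq)]
    · rw [charVec_apply_of_notMem hq]
      exact charVec_nonneg A p

theorem exists_charVec_eq_of_mem_extremePoints_orderPolytope [Fintype P] {x : P → ℝ}
    (hx : x ∈ (orderPolytope P).extremePoints ℝ) :
    ∃ A : Finset P, IsLowerSet (A : Set P) ∧ charVec A = x := by
  -- `t ^ 2` and `2 * t - t ^ 2` are increasing self-maps of `[0, 1]` with average `t`, so
  -- extremality yields `x p ^ 2 = x p`.
  have hsq : (fun p => x p ^ 2) ∈ orderPolytope P := by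
    refine ⟨fun p => ⟨sq_nonneg _, pow_le_one₀ (hx.1.1 p).1 (hx.1.1 p).2⟩, fun p q hpq => ?_⟩
    exact pow_le_pow_left₀ (hx.1.1 q).1 (hx.1.2 p q hpq) 2
  have hsq' : (fun p => 2 * x p - x p ^ 2) ∈ orderPolytope P := by
    refine ⟨fun p => ⟨?_, ?_⟩, fun p q hpq => ?_⟩
    · nlinarith [(hx.1.1 p).1, (hx.1.1 p).2]
    · nlinarith [sq_nonneg (1 - x p)]
    · nlinarith [(hx.1.1 p).2, (hx.1.1 q).2, hx.1.2 p q hpq]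
  have heq := hx.2 hsq hsq' ⟨1 / 2, 1 / 2, by norm_num, by norm_num, by norm_num, by
    ext p
    simp
    ring⟩
  have hA : charVec (Finset.univ.filter fun p => x p = 1) = x := by
    ext p
    by_cases hp : x p = 1
    · simp [charVec, hp]
    · have : x p * (x p - 1) = 0 := by
        have := congrFun heq p
        linarith
      rcases mul_eq_zero.1 this with h | h
      · simp [charVec, h]
      · exact absurd (by linarith) hp
  refine ⟨_, charVec_mem_orderPolytope_iff.1 ?_, hA⟩
  rw [hA]
  exact hx.1

theorem finite_triangularTwoFaces_orderPolytope [Finite P] :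
    (triangularTwoFaces (orderPolytope P)).Finite := by
  have := Fintype.ofFinite P
  refine finite_triangularTwoFaces ((finite_range (charVec (P := P))).subset fun x hx => ?_)
  obtain ⟨A, -, hA⟩ := exists_charVec_eq_of_mem_extremePoints_orderPolytope hx
  exact ⟨A, hA⟩

theorem mem_of_charVec_add_eq {T : Set (Finset P)}
    (hT : IsExtreme ℝ (orderPolytope P) (convexHull ℝ (charVec '' T))) {A B U V : Finset P}
    (hA : A ∈ T) (hB : B ∈ T) (hU : IsLowerSet (U : Set P)) (hV : IsLowerSet (V : Set P))
    (h : charVec A + charVec B = charVec U + charVec V) : U ∈ T ∧ V ∈ T := by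
  have hmem : (1 / 2 : ℝ) • charVec A + (1 / 2 : ℝ) • charVec B ∈ convexHull ℝ (charVec '' T) :=
    convex_convexHull ℝ _ (subset_convexHull ℝ _ (mem_image_of_mem _ hA))
      (subset_convexHull ℝ _ (mem_image_of_mem _ hB)) (by norm_num) (by norm_num) (by norm_num)
  rw [← smul_add, h, smul_add] at hmem
  have hseg : (1 / 2 : ℝ) • charVec U + (1 / 2 : ℝ) • charVec V ∈
      openSegment ℝ (charVec U) (charVec V) :=
    ⟨1 / 2, 1 / 2, by norm_num, by norm_num, by norm_num, rfl⟩
  have hU' := charVec_mem_orderPolytope_iff.2 hU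
  have hV' := charVec_mem_orderPolytope_iff.2 hV
  exact ⟨mem_of_charVec_mem_convexHull (hT.left_mem_of_mem_openSegment hU' hV' hmem hseg),
    mem_of_charVec_mem_convexHull (hT.right_mem_of_mem_openSegment hU' hV' hmem hseg)⟩

/-- The difference `B \ A` is not a set of at least two elements of the same height. -/
def IsSingletonOrSpread {α : Type*} (h : P → α) (A B : Finset P) : Prop :=
  ∀ p ∈ B \ A, ∀ q ∈ B \ A, p ≠ q → ∃ r ∈ B \ A, h r ≠ h p

/-- Three nested lower sets whose indicators span a triangular face of the order polytope. -/
structure IsLowerTriple {α : Type*} (h : P → α) (I J K : Finset P) : Prop where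
  lower_left : IsLowerSet (I : Set P)
  lower_mid : IsLowerSet (J : Set P)
  lower_right : IsLowerSet (K : Set P)
  ssubset_left : I ⊂ J
  ssubset_right : J ⊂ K
  spread_left : IsSingletonOrSpread h I J
  spread_right : IsSingletonOrSpread h J K
  spread : IsSingletonOrSpread h I K

/-- Replacing an incomparable pair by its union and intersection keeps the midpoint; both would have
to be the one remaining vertex `Z`. -/
theorem subset_or_subset_of_isExtreme {A B C X Y Z : Finset P}
    (hT : IsExtreme ℝ (orderPolytope P) (convexHull ℝ (charVec '' {A, B, C})))
    (hlow : ∀ D ∈ ({A, B, C} : Set (Finset P)), IsLowerSet (D : Set P))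
    (hXYZ : ({A, B, C} : Set (Finset P)) = {X, Y, Z}) : X ⊆ Y ∨ Y ⊆ X := by
  rw [hXYZ] at hT hlow
  by_contra! hcon
  have hX := hlow X (by simp)
  have hY := hlow Y (by simp)
  have h := mem_of_charVec_add_eq hT (A := X) (B := Y) (U := X ∪ Y) (V := X ∩ Y) (by simp)
    (by simp) (by simpa using hX.union hY) (by simpa using hX.inter hY) (by
      ext p
      by_cases h1 : p ∈ X <;> by_cases h2 : p ∈ Y <;> simp [charVec, h1, h2])
  have hU : X ∪ Y = Z := by
    rcases h.1 with h | h | h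
    · exact absurd (Finset.union_eq_left.1 h) hcon.2
    · exact absurd (Finset.union_eq_right.1 h) hcon.1
    · exact h
  have hV : X ∩ Y = Z := by
    rcases h.2 with h | h | h
    · exact absurd (Finset.inter_eq_left.1 h) hcon.1
    · exact absurd (Finset.inter_eq_right.1 h) hcon.2
    · exact h
  refine hcon.1 fun p hp => ?_
  have : p ∈ X ∩ Y := hV ▸ hU ▸ Finset.mem_union_left _ hp
  exact (Finset.mem_inter.1 this).2

/-- If `Y \ X` had several elements, all of one height, moving one of them from `Y` to `X` would
give two lower sets with the same midpoint, both forced to equal `Z`. -/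
theorem isSingletonOrSpread_of_isExtreme {α : Type*} [LinearOrder α] {h : P → α}
    (hh : ∀ p q, p < q ↔ h p < h q) {A B C X Y Z : Finset P}
    (hT : IsExtreme ℝ (orderPolytope P) (convexHull ℝ (charVec '' {A, B, C})))
    (hlow : ∀ D ∈ ({A, B, C} : Set (Finset P)), IsLowerSet (D : Set P))
    (hXYZ : ({A, B, C} : Set (Finset P)) = {X, Y, Z}) :
    IsSingletonOrSpread h X Y := by
  rw [hXYZ] at hT hlow
  have hX := hlow X (by simp)
  have hY := hlow Y (by simp)
  intro p hp q hq hpq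
  by_contra! hcon
  rw [Finset.mem_sdiff] at hp hq
  have hU : IsLowerSet ((insert p X : Finset P) : Set P) := by
    intro a b hba ha
    simp only [Finset.coe_insert, mem_insert_iff, Finset.mem_coe] at ha ⊢
    rcases ha with rfl | ha
    · rcases hba.eq_or_lt with h' | h'
      · exact Or.inl h'
      · by_contra! hb
        have := hcon b (Finset.mem_sdiff.2 ⟨hY hba hp.1, hb.2⟩)
        exact ((hh _ _).1 h').ne this
    · exact Or.inr (hX hba ha)
  have hV : IsLowerSet ((Y.erase p : Finset P) : Set P) := by
    intro a b hba ha
    simp only [Finset.mem_coe, Finset.mem_erase] at ha ⊢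
    refine ⟨?_, hY hba ha.2⟩
    rintro rfl
    by_cases haX : a ∈ X
    · exact hp.2 (hX hba haX)
    · have := hcon a (Finset.mem_sdiff.2 ⟨ha.2, haX⟩)
      exact ((hh _ _).1 (lt_of_le_of_ne hba (Ne.symm ha.1))).ne this.symm
  have h := mem_of_charVec_add_eq hT (A := X) (B := Y) (U := insert p X) (V := Y.erase p)
    (by simp) (by simp) hU hV (by
      ext r
      by_cases h0 : r = p
      · subst h0
        simp [charVec, hp]
      · by_cases h1 : r ∈ X <;> by_cases h2 : r ∈ Y <;> simp [charVec, h0, h1, h2])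
  have hUZ : insert p X = Z := by
    rcases h.1 with h | h | h
    · exact absurd (h ▸ Finset.mem_insert_self p X) hp.2
    · exact absurd (h ▸ hq.1) (by simp [hpq.symm, hq.2])
    · exact h
  have hVZ : Y.erase p = Z := by
    rcases h.2 with h | h | h
    · exact absurd (h ▸ Finset.mem_erase.2 ⟨hpq.symm, hq.1⟩) hq.2
    · exact absurd (h ▸ hp.1) (by simp)
    · exact h
  exact absurd (hVZ ▸ hUZ ▸ Finset.mem_insert_self p X) (by simp : p ∉ Y.erase p)

theorem exists_isLowerTriple_of_mem_triangularTwoFaces [Fintype P] {α : Type*} [LinearOrder α]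
    {h : P → α} (hh : ∀ p q, p < q ↔ h p < h q) {F : Set (P → ℝ)}
    (hF : F ∈ triangularTwoFaces (orderPolytope P)) :
    ∃ I J K : Finset P, IsLowerTriple h I J K ∧ F = convexHull ℝ (charVec '' {I, J, K}) := by
  obtain ⟨a, b, c, hab, hac, hbc, habc⟩ := exists_extremePoints_eq_of_mem_triangularTwoFaces hF
  have hhull := convexHull_extremePoints_of_mem_triangularTwoFaces hF
  have hext := hF.1.isExposed.isExtreme
  have hvert : ∀ x ∈ ({a, b, c} : Set (P → ℝ)),
      ∃ A : Finset P, IsLowerSet (A : Set P) ∧ charVec A = x := fun x hx =>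
    exists_charVec_eq_of_mem_extremePoints_orderPolytope
      (hext.extremePoints_subset_extremePoints (habc ▸ hx))
  obtain ⟨A, hA, rfl⟩ := hvert a (by simp)
  obtain ⟨B, hB, rfl⟩ := hvert b (by simp)
  obtain ⟨C, hC, rfl⟩ := hvert c (by simp)
  have hAB : A ≠ B := fun h => hab (h ▸ rfl)
  have hAC : A ≠ C := fun h => hac (h ▸ rfl)
  have hBC : B ≠ C := fun h => hbc (h ▸ rfl)
  have hFeq : F = convexHull ℝ (charVec '' {A, B, C}) := by
    rw [← hhull, habc, image_insert_eq, image_pair]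
  rw [hFeq] at hext
  have hlow : ∀ D ∈ ({A, B, C} : Set (Finset P)), IsLowerSet (D : Set P) := by
    rintro D (rfl | rfl | rfl) <;> assumption
  have key : ∀ I J K : Finset P, ({A, B, C} : Set (Finset P)) = {I, J, K} → I ≠ J → J ≠ K →
      I ⊆ J → J ⊆ K →
      ∃ I J K : Finset P, IsLowerTriple h I J K ∧ F = convexHull ℝ (charVec '' {I, J, K}) := by
    intro I J K hIJK hne hne' hIJ hJK
    refine ⟨I, J, K, ⟨?_, ?_, ?_, hIJ.ssubset_of_ne hne, hJK.ssubset_of_ne hne', ?_, ?_, ?_⟩,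
      by rw [hFeq, hIJK]⟩
    · exact hlow I (by simp [hIJK])
    · exact hlow J (by simp [hIJK])
    · exact hlow K (by simp [hIJK])
    · exact isSingletonOrSpread_of_isExtreme hh hext hlow hIJK
    · exact isSingletonOrSpread_of_isExtreme hh hext hlow (Z := I)
        (hIJK.trans (by ext; simp; tauto))
    · exact isSingletonOrSpread_of_isExtreme hh hext hlow (Z := J)
        (hIJK.trans (by ext; simp; tauto))
  have e1 : ({A, B, C} : Set (Finset P)) = {A, C, B} := by ext; simp; tauto
  have e2 : ({A, B, C} : Set (Finset P)) = {B, A, C} := by ext; simp; tauto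
  have e3 : ({A, B, C} : Set (Finset P)) = {B, C, A} := by ext; simp; tauto
  have e4 : ({A, B, C} : Set (Finset P)) = {C, A, B} := by ext; simp; tauto
  have e5 : ({A, B, C} : Set (Finset P)) = {C, B, A} := by ext; simp; tauto
  -- Of the eight orientations of the three pairs, six are linear orders and the two cyclic ones
  -- make the sets equal.
  rcases subset_or_subset_of_isExtreme hext hlow rfl with h1 | h1 <;>
  rcases subset_or_subset_of_isExtreme hext hlow e1 with h2 | h2 <;>
  rcases subset_or_subset_of_isExtreme hext hlow e3 with h3 | h3
  · exact key A B C rfl hAB hBC h1 h3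
  · exact key A C B e1 hAC hBC.symm h2 h3
  · exact absurd (h1.antisymm (h3.trans h2)) hAB
  · exact key C A B e4 hAC.symm hAB h2 h1
  · exact key B A C e2 hAB.symm hAC h1 h2
  · exact absurd (h1.antisymm (h2.trans h3)) hAB.symm
  · exact key B C A e3 hBC hAC.symm h3 h2
  · exact key C B A e5 hBC.symm hAB.symm h3 h1

end OrderPolytope

theorem IsSingletonOrSpread.exists_eq_singleton {P α : Type*} [DecidableEq P] {h : P → α}
    {A B : Finset P} (hAB : IsSingletonOrSpread h A B) (hss : A ⊂ B) {i : α}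
    (hi : ∀ p ∈ B \ A, h p = i) :
    ∃ p, B \ A = {p} := by
  obtain ⟨p, hpB, hpA⟩ := Finset.exists_of_ssubset hss
  have hp : p ∈ B \ A := Finset.mem_sdiff.2 ⟨hpB, hpA⟩
  refine ⟨p, Finset.eq_singleton_iff_unique_mem.2 ⟨hp, fun q hq => ?_⟩⟩
  by_contra hne
  obtain ⟨r, hr, hrq⟩ := hAB q hq p hp hne
  exact hrq ((hi r hr).trans (hi q hq).symm)

/-! ### Layers and triples of antichains -/

section Layers

variable {P : Type*} {α : Type*} [LinearOrder α] (h : P → α)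

/-- The elements of `A` of largest height. -/
def topLayer (A : Finset P) : Finset P := A.filter fun p => ∀ q ∈ A, h q ≤ h p

/-- The elements of `A` of smallest height. -/
def botLayer (A : Finset P) : Finset P := A.filter fun p => ∀ q ∈ A, h p ≤ h q

theorem exists_mem_topLayer_iff {A : Finset P} (hA : A.Nonempty) :
    ∃ k, (∀ p, p ∈ topLayer h A ↔ p ∈ A ∧ h p = k) ∧ (topLayer h A).Nonempty ∧
      ∀ p ∈ A, h p ≤ k := by
  obtain ⟨m, hm, hmax⟩ := A.exists_max_image h hA
  refine ⟨h m, fun p => ?_, ⟨m, by simp [topLayer, hm]; exact hmax⟩, hmax⟩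
  simp only [topLayer, Finset.mem_filter]
  exact and_congr_right fun hp =>
    ⟨fun hp' => (hmax p hp).antisymm (hp' m hm), fun hp' q hq => hp' ▸ hmax q hq⟩

theorem exists_mem_botLayer_iff {A : Finset P} (hA : A.Nonempty) :
    ∃ k, (∀ p, p ∈ botLayer h A ↔ p ∈ A ∧ h p = k) ∧ (botLayer h A).Nonempty ∧
      ∀ p ∈ A, k ≤ h p :=
  -- `botLayer` unfolds to `topLayer` for the dual order on heights.
  exists_mem_topLayer_iff (α := αᵒᵈ) h hA

theorem botLayer_eq {h : P → α} {A R : Finset P} {i : α} (hR : R.Nonempty) (hA : ∀ p ∈ A, i ≤ h p)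
    (hRA : ∀ p, p ∈ R ↔ p ∈ A ∧ h p = i) : botLayer h A = R := by
  obtain ⟨r, hr⟩ := hR
  rw [hRA] at hr
  ext p
  rw [hRA, botLayer, Finset.mem_filter]
  exact and_congr_right fun hp =>
    ⟨fun hp' => (hr.2 ▸ hp' r hr.1).antisymm (hA p hp), fun hp' q hq => hp' ▸ hA q hq⟩

theorem topLayer_eq {h : P → α} {A R : Finset P} {i : α} (hR : R.Nonempty) (hA : ∀ p ∈ A, h p ≤ i)
    (hRA : ∀ p, p ∈ R ↔ p ∈ A ∧ h p = i) : topLayer h A = R :=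
  botLayer_eq (α := αᵒᵈ) hR hA hRA

variable [DecidableEq P]

/-- Triples of antichains whose indicators span a triangular face of the chain polytope. -/
inductive IsAntichainTriple : Finset P → Finset P → Finset P → Prop
  | layers {R X S : Finset P} {i j k : α} (hR : R.Nonempty) (hX : X.Nonempty) (hS : S.Nonempty)
      (hRi : ∀ p ∈ R, h p = i) (hXj : ∀ p ∈ X, h p = j) (hSk : ∀ p ∈ S, h p = k)
      (hij : i < j) (hjk : j < k) : IsAntichainTriple R X S
  | edge_left {X S : Finset P} {p : P} {k : α} (hp : p ∉ X) (hX : X.Nonempty) (hS : S.Nonempty)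
      (hXi : ∀ x ∈ X, h x = h p) (hSk : ∀ s ∈ S, h s = k) (hik : h p < k) :
      IsAntichainTriple (insert p X) X S
  | edge_right {R X : Finset P} {q : P} {i : α} (hq : q ∉ X) (hX : X.Nonempty) (hR : R.Nonempty)
      (hXk : ∀ x ∈ X, h x = h q) (hRi : ∀ r ∈ R, h r = i) (hik : i < h q) :
      IsAntichainTriple R X (insert q X)
  | origin {p q : P} (hpq : h p < h q) : IsAntichainTriple {p} ∅ {q}

variable {h}

theorem IsAntichainTriple.ne_and_ne {R X S : Finset P} (hT : IsAntichainTriple h R X S) :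
    X ≠ R ∧ X ≠ S := by
  cases hT with
  | layers hR hX hS hRi hXj hSk hij hjk =>
    obtain ⟨x, hx⟩ := hX
    have hx' := hXj x hx
    exact ⟨fun he => hij.ne ((hRi x (he ▸ hx)).symm.trans hx'),
      fun he => hjk.ne (hx'.symm.trans (hSk x (he ▸ hx)))⟩
  | edge_left hp hX hS hXi hSk hik =>
    obtain ⟨x, hx⟩ := hX
    exact ⟨fun he => hp (he.symm ▸ Finset.mem_insert_self _ _),
      fun he => hik.ne ((hXi x hx).symm.trans (hSk x (he ▸ hx)))⟩
  | edge_right hq hX hR hXk hRi hik =>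
    obtain ⟨x, hx⟩ := hX
    exact ⟨fun he => hik.ne ((hRi x (he ▸ hx)).symm.trans (hXk x hx)),
      fun he => hq (he.symm ▸ Finset.mem_insert_self _ _)⟩
  | origin hpq => exact ⟨(Finset.singleton_ne_empty _).symm, (Finset.singleton_ne_empty _).symm⟩

theorem IsAntichainTriple.botLayer_union {R X S : Finset P} (hT : IsAntichainTriple h R X S) :
    botLayer h (R ∪ X ∪ S) = R := by
  cases hT with
  | @layers _ _ _ i j k hR hX hS hRi hXj hSk hij hjk =>
    apply botLayer_eq (i := i) hR <;> grind
  | @edge_left _ _ p k hp hX hS hXi hSk hik =>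
    apply botLayer_eq (i := h p) (Finset.insert_nonempty _ _) <;> grind
  | @edge_right _ _ q i hq hX hR hXk hRi hik =>
    apply botLayer_eq (i := i) hR <;> grind
  | @origin p q hpq =>
    apply botLayer_eq (i := h p) (Finset.singleton_nonempty _) <;> grind

theorem IsAntichainTriple.topLayer_union {R X S : Finset P} (hT : IsAntichainTriple h R X S) :
    topLayer h (R ∪ X ∪ S) = S := by
  cases hT with
  | @layers _ _ _ i j k hR hX hS hRi hXj hSk hij hjk =>
    apply topLayer_eq (i := k) hS <;> grind
  | @edge_left _ _ p k hp hX hS hXi hSk hik =>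
    apply topLayer_eq (i := k) hS <;> grind
  | @edge_right _ _ q i hq hX hR hXk hRi hik =>
    apply topLayer_eq (i := h q) (Finset.insert_nonempty _ _) <;> grind
  | @origin p q hpq =>
    apply topLayer_eq (i := h q) (Finset.singleton_nonempty _) <;> grind

/-- `R` and `S` are the bottom and top layers of the union, and `X` differs from both. -/
theorem IsAntichainTriple.eq_of_set_eq {R X S R' X' S' : Finset P}
    (hT : IsAntichainTriple h R X S) (hT' : IsAntichainTriple h R' X' S')
    (heq : ({R, X, S} : Set (Finset P)) = {R', X', S'}) : R = R' ∧ X = X' ∧ S = S' := by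
  have hunion : R ∪ X ∪ S = R' ∪ X' ∪ S' := by
    ext p
    have h1 : p ∈ R ∪ X ∪ S ↔ ∃ D ∈ ({R, X, S} : Set (Finset P)), p ∈ D := by simp
    have h2 : p ∈ R' ∪ X' ∪ S' ↔ ∃ D ∈ ({R', X', S'} : Set (Finset P)), p ∈ D := by
      simp
    rw [h1, h2, heq]
  have hR : R = R' := by rw [← hT.botLayer_union, hunion, hT'.botLayer_union]
  have hS : S = S' := by rw [← hT.topLayer_union, hunion, hT'.topLayer_union]
  subst hR hS
  refine ⟨rfl, ?_, rfl⟩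
  have hX : X ∈ ({R, X', S} : Set (Finset P)) := heq ▸ (by simp)
  rcases hX with hX | hX | hX
  · exact absurd hX hT.ne_and_ne.1
  · exact hX
  · exact absurd hX hT.ne_and_ne.2

/-! ### From flags of lower sets to antichain triples and back -/

variable [Fintype P]

variable (h)


/-- The lower set whose top layer is the subset `M` of a layer. -/
def belowLayer (M : Finset P) : Finset P := Finset.univ.filter fun p => p ∈ M ∨ ∃ m ∈ M, h p < h m

/-- The upper set whose bottom layer is the subset `M` of a layer. -/
def aboveLayer (M : Finset P) : Finset P := Finset.univ.filter fun p => p ∈ M ∨ ∃ m ∈ M, h m < h p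

/-- The full layer right below `S`. -/
def layerBefore (S : Finset P) : Finset P :=
  topLayer h (Finset.univ.filter fun p => ∀ s ∈ S, h p < h s)

theorem belowLayer_topLayer {A : Finset P} (hA : ∀ p ∈ A, ∀ q, h q < h p → q ∈ A) :
    belowLayer h (topLayer h A) = A := by
  rcases A.eq_empty_or_nonempty with rfl | hne
  · simp [belowLayer, topLayer]
  obtain ⟨k, hk, ⟨m, hm⟩, hmax⟩ := exists_mem_topLayer_iff h hne
  ext p
  simp only [belowLayer, Finset.mem_filter, Finset.mem_univ, true_and, hk]
  rw [hk] at hm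
  constructor
  · rintro (hp | ⟨m, hm, hlt⟩)
    · exact hp.1
    · exact hA m hm.1 p hlt
  · intro hp
    rcases (hmax p hp).eq_or_lt with h' | h'
    · exact Or.inl ⟨hp, h'⟩
    · exact Or.inr ⟨m, hm, hm.2 ▸ h'⟩

theorem aboveLayer_botLayer {A : Finset P} (hA : ∀ p ∈ A, ∀ q, h p < h q → q ∈ A) :
    aboveLayer h (botLayer h A) = A :=
  belowLayer_topLayer (α := αᵒᵈ) h hA

variable {h}

theorem IsAntichainTriple.convexHull_mem [PartialOrder P] (hh : ∀ p q, p < q ↔ h p < h q)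
    {R X S : Finset P} (hT : IsAntichainTriple h R X S) :
    convexHull ℝ (charVec '' {R, X, S}) ∈ triangularTwoFaces (chainPolytope P) := by
  have hanti : ∀ {A : Finset P} {i : α}, (∀ p ∈ A, h p = i) →
      IsAntichain (· ≤ ·) (A : Set P) := by
    intro A i hA p hp q hq hne hle
    exact ((hh p q).1 (lt_of_le_of_ne hle hne)).ne ((hA p hp).trans (hA q hq).symm)
  cases hT with
  | layers hR hX hS hRi hXj hSk hij hjk =>
    refine triangularTwoFaces_of_three_layers (hanti hRi) (hanti hXj) (hanti hSk) hR hX hS ?_ ?_ <;>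
      grind
  | edge_left hp hX hS hXi hSk hik =>
    rw [Set.insert_comm]
    exact triangularTwoFaces_of_two_layers hp (hanti (i := h _) ((Finset.forall_mem_insert _ _ _).2 ⟨rfl, hXi⟩))
      (hanti hSk) hX hS (by grind)
  | edge_right hq hX hR hXk hRi hik =>
    rw [Set.insert_comm, Set.pair_comm]
    exact triangularTwoFaces_of_two_layers hq (hanti (i := h _) ((Finset.forall_mem_insert _ _ _).2 ⟨rfl, hXk⟩))
      (hanti hRi) hX hR (by grind)
  | origin hpq => exact triangularTwoFaces_of_lt ((hh _ _).2 hpq)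

variable (h)

/-- The third antichain attached to a triple `I ⊂ J ⊂ K` of lower sets, besides the bottom layer
of the complement of `I` and the top layer of `K`. -/
def midLayer (I J K : Finset P) : Finset P :=
  if ∀ r ∈ botLayer h Iᶜ, ∀ m ∈ topLayer h J, h r < h m then topLayer h J
  else if ∃ n ∈ botLayer h Jᶜ, ∃ m ∈ topLayer h J, h n = h m then botLayer h Jᶜ
  else if (topLayer h K).card = 1 then ∅
  else layerBefore h (topLayer h K)

/-- Recovers the lower set `J` from the three antichains attached to `I ⊂ J ⊂ K`. -/
def recoverMid (R X S : Finset P) : Finset P :=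
  if X = ∅ then Finset.univ.filter fun p => ∃ r ∈ R, h p ≤ h r
  else if ∃ x ∈ X, ∃ r ∈ R, h x = h r then (aboveLayer h X)ᶜ
  else if X = layerBefore h S ∧ S.card ≠ 1 then Finset.univ.filter fun p => ∃ r ∈ R, h p ≤ h r
  else belowLayer h X

variable {h}

/-- Let `i`, `j`, `j'`, `k` be the heights of `R`, of the top of `J`, of the bottom of `Jᶜ`, and of
`S`. Then `i ≤ j ≤ j' ≤ k`, and a difference confined to one layer is a singleton; the four cases
follow from these facts. -/
theorem IsLowerTriple.midLayer_spec [PartialOrder P] (hh : ∀ p q, p < q ↔ h p < h q)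
    {I J K : Finset P} (hT : IsLowerTriple h I J K) :
    IsAntichainTriple h (botLayer h Iᶜ) (midLayer h I J K) (topLayer h K) ∧
      recoverMid h (botLayer h Iᶜ) (midLayer h I J K) (topLayer h K) = J := by
  obtain ⟨hI, hJ, hK, hIJ, hJK, gIJ, gJK, gIK⟩ := hT
  have lJ : ∀ p ∈ J, ∀ q, h q < h p → q ∈ J := fun p hp q hq => hJ ((hh q p).2 hq).le hp
  obtain ⟨d, hdJ, hdI⟩ := Finset.exists_of_ssubset hIJ
  obtain ⟨e, heK, heJ⟩ := Finset.exists_of_ssubset hJK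
  obtain ⟨i, hRmem, hRne, hRmin⟩ := exists_mem_botLayer_iff h (A := Iᶜ) ⟨d, by simpa using hdI⟩
  obtain ⟨j, hMmem, hMne, hMmax⟩ := exists_mem_topLayer_iff h (A := J) ⟨d, hdJ⟩
  obtain ⟨j', hNmem, hNne, hNmin⟩ := exists_mem_botLayer_iff h (A := Jᶜ) ⟨e, by simpa using heJ⟩
  obtain ⟨k, hSmem, hSne, hSmax⟩ := exists_mem_topLayer_iff h (A := K) ⟨e, heK⟩
  have hbelow := belowLayer_topLayer h lJ
  have habove := aboveLayer_botLayer h (A := Jᶜ) (by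
    simp only [Finset.mem_compl]
    exact fun p hp q hq hqJ => hp (lJ q hqJ p hq))
  simp only [Finset.mem_compl] at hRmem hRmin hNmem hNmin
  have hmid : midLayer h I J K = if i < j then topLayer h J
      else if j' = j then botLayer h Jᶜ
      else if (topLayer h K).card = 1 then ∅ else layerBefore h (topLayer h K) := by
    have c1 : (∀ r ∈ botLayer h Iᶜ, ∀ m ∈ topLayer h J, h r < h m) ↔ i < j := by
      obtain ⟨r, hr⟩ := hRne
      obtain ⟨m, hm⟩ := hMne
      grind
    have c2 : (∃ n ∈ botLayer h Jᶜ, ∃ m ∈ topLayer h J, h n = h m) ↔ j' = j := by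
      obtain ⟨n, hn⟩ := hNne
      obtain ⟨m, hm⟩ := hMne
      grind
    rw [midLayer]
    simp only [c1, c2]
  set R := botLayer h Iᶜ
  set M := topLayer h J
  set N := botLayer h Jᶜ
  set S := topLayer h K
  have hij : i ≤ j := (hRmin d hdI).trans (hMmax d hdJ)
  have hj'k : j' ≤ k := (hNmin e heJ).trans (hSmax e heK)
  have hjj' : j ≤ j' := by
    obtain ⟨n, hn⟩ := hNne
    obtain ⟨m, hm⟩ := hMne
    by_contra! hlt
    exact ((hNmem n).1 hn).1 (lJ m ((hMmem m).1 hm).1 n (by grind))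
  have hRi : ∀ r ∈ R, h r = i := fun r hr => ((hRmem r).1 hr).2
  have hMj : ∀ r ∈ M, h r = j := fun r hr => ((hMmem r).1 hr).2
  have hNj' : ∀ r ∈ N, h r = j' := fun r hr => ((hNmem r).1 hr).2
  have hSk : ∀ r ∈ S, h r = k := fun r hr => ((hSmem r).1 hr).2
  -- Here `J` consists of complete layers, the last one at height `i`.
  have hfilter : j ≤ i → j < j' → (Finset.univ.filter fun p => ∃ r ∈ R, h p ≤ h r) = J := by
    intro hji hlt
    obtain ⟨r, hr⟩ := hRne
    ext p
    simp only [Finset.mem_filter, Finset.mem_univ, true_and]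
    grind
  have hStop : j' = k → ∃ q, K \ J = {q} := by
    intro hk
    refine gJK.exists_eq_singleton hJK (i := k) ?_
    grind
  have hB : ∀ p, h p < k → ∃ b, (∀ p, p ∈ layerBefore h S ↔ h p < k ∧ h p = b) ∧
      (layerBefore h S).Nonempty ∧ ∀ p, h p < k → h p ≤ b := by
    intro p hp
    have hiff : ∀ p, p ∈ (Finset.univ.filter fun p => ∀ s ∈ S, h p < h s) ↔ h p < k := by
      obtain ⟨s, hs⟩ := hSne
      grind
    obtain ⟨b, h1, h2, h3⟩ := exists_mem_topLayer_iff h ⟨p, (hiff p).2 hp⟩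
    simp only [hiff] at h1 h3
    exact ⟨b, h1, h2, h3⟩
  have hcard : j < j' → S.card ≠ 1 → j' < k := by
    intro hlt hc
    refine lt_of_le_of_ne hj'k fun hk => hc ?_
    obtain ⟨q, hq⟩ := hStop hk
    refine Finset.card_eq_one.2 ⟨q, ?_⟩
    ext p
    have : p ∈ K \ J ↔ p = q := by simp [hq]
    have : q ∈ K \ J := by simp [hq]
    rw [hSmem, Finset.mem_singleton]
    grind
  rw [hmid]
  split_ifs with c1 c2 c3
  · constructor
    · rcases (hjj'.trans hj'k).lt_or_eq with hjk | hjk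
      · exact .layers hRne hMne hSne hRi hMj hSk c1 hjk
      · obtain ⟨q, hq⟩ := hStop (hj'k.antisymm (hjk ▸ hjj'))
        have hq' : q ∈ K \ J := by simp [hq]
        have hS : S = insert q M := by
          ext p
          have : p ∈ K \ J ↔ p = q := by simp [hq]
          rw [Finset.mem_insert, hSmem, hMmem]
          grind
        rw [hS]
        have hqk : h q = j := by grind
        exact .edge_right (by grind) hMne hRne (by grind) hRi (by grind)
    -- No clash with the fourth case: if `M` were the full layer below `S`, then `Jᶜ` would start at
    -- height `k`, making `K \ J` a singleton equal to `S`.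
    · rw [recoverMid, if_neg hMne.ne_empty, if_neg (by grind), if_neg, hbelow]
      rintro ⟨hMB, hc⟩
      have hjk : j ≤ k := hjj'.trans hj'k
      obtain ⟨n, hn⟩ := hNne
      obtain ⟨m, hm⟩ := hMne
      have hmk : h m < k := by
        obtain ⟨s, hs⟩ := hSne
        simp only [hMB, layerBefore, topLayer, Finset.mem_filter] at hm
        exact hSk s hs ▸ hm.1.2 s hs
      obtain ⟨b, hb, -, hbmax⟩ := hB m hmk
      rw [← hMB] at hb
      have hnk : h n < k := by
        by_contra! hle
        exact (hcard (by grind) hc).not_ge (by grind)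
      have hnM : n ∈ M := (hb n).2 ⟨hnk, by grind⟩
      exact ((hNmem n).1 hn).1 ((hMmem n).1 hnM).1
  -- `J` adds a single element `p` to `I` without completing the layer, so `R` is `N` with `p`
  -- inserted.
  · have hji : j = i := le_antisymm (not_lt.1 c1) hij
    obtain ⟨p, hp⟩ := gIJ.exists_eq_singleton hIJ (i := i) (by grind)
    have hp' : p ∈ J \ I := by simp [hp]
    have hR : R = insert p N := by
      ext q
      have : q ∈ J \ I ↔ q = p := by simp [hp]
      rw [Finset.mem_insert, hRmem, hNmem]
      grind
    have hpi : h p = i := by grind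
    have hik : i < k := by
      refine lt_of_le_of_ne (by grind) fun hik => ?_
      obtain ⟨q, hq⟩ := gIK.exists_eq_singleton (hIJ.trans hJK) (i := i) (by grind)
      have hd : d ∈ K \ I := Finset.mem_sdiff.2 ⟨hJK.1 hdJ, hdI⟩
      have he : e ∈ K \ I := Finset.mem_sdiff.2 ⟨heK, fun h' => heJ (hIJ.1 h')⟩
      rw [hq, Finset.mem_singleton] at hd he
      exact heJ (he ▸ hd ▸ hdJ)
    constructor
    · rw [hR]
      exact .edge_left (by grind) hNne hSne (by grind) hSk (by grind)
    · obtain ⟨n, hn⟩ := hNne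
      obtain ⟨r, hr⟩ := hRne
      rw [recoverMid, if_neg (Finset.ne_empty_of_mem hn),
        if_pos ⟨n, hn, r, hr, by grind⟩, habove, compl_compl]
  -- `J` completes its layer, so `R` and `S` are singletons and the empty antichain serves as third
  -- vertex.
  · have hji : j = i := le_antisymm (not_lt.1 c1) hij
    have hlt : j < j' := lt_of_le_of_ne hjj' (Ne.symm c2)
    constructor
    · obtain ⟨p, hp⟩ := gIJ.exists_eq_singleton hIJ (i := i) (by grind)
      have hp' : p ∈ J \ I := by simp [hp]
      have hR : R = {p} := by
        ext q
        have : q ∈ J \ I ↔ q = p := by simp [hp]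
        rw [Finset.mem_singleton, hRmem]
        grind
      obtain ⟨q, hq⟩ := Finset.card_eq_one.1 c3
      rw [hR, hq]
      have hqk : h q = k := hSk q (by simp [hq])
      exact .origin (by grind)
    · rw [recoverMid, if_pos rfl, hfilter hji.le hlt]
  -- `S` is not a singleton, so `j' < k` and the layer just below `S` lies strictly above `R`.
  · have hji : j = i := le_antisymm (not_lt.1 c1) hij
    have hlt : j < j' := lt_of_le_of_ne hjj' (Ne.symm c2)
    obtain ⟨n, hn⟩ := hNne
    obtain ⟨b, hb, hBne, hbmax⟩ := hB n (by have := hcard hlt c3; grind)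
    have hib : i < b := by
      have := hbmax n (by have := hcard hlt c3; grind)
      grind
    constructor
    · exact .layers hRne hBne hSne hRi (fun p hp => ((hb p).1 hp).2) hSk hib (by
        obtain ⟨p, hp⟩ := hBne
        have := (hb p).1 hp
        grind)
    · rw [recoverMid, if_neg hBne.ne_empty, if_neg (by grind), if_pos ⟨rfl, c3⟩,
        hfilter hji.le hlt]

theorem IsLowerTriple.eq_of_convexHull_eq [PartialOrder P] (hh : ∀ p q, p < q ↔ h p < h q)
    {I J K I' J' K' : Finset P} (hT : IsLowerTriple h I J K) (hT' : IsLowerTriple h I' J' K')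
    (heq : convexHull ℝ (charVec '' {botLayer h Iᶜ, midLayer h I J K, topLayer h K}) =
      convexHull ℝ (charVec '' {botLayer h I'ᶜ, midLayer h I' J' K', topLayer h K'})) :
    I = I' ∧ J = J' ∧ K = K' := by
  obtain ⟨hA, hJ⟩ := hT.midLayer_spec hh
  obtain ⟨hA', hJ'⟩ := hT'.midLayer_spec hh
  obtain ⟨hR, hX, hS⟩ := hA.eq_of_set_eq hA' (convexHull_charVec_injective heq)
  have hlow : ∀ {A : Finset P}, IsLowerSet (A : Set P) →
      ∀ p ∈ A, ∀ q, h q < h p → q ∈ A := fun hA p hp q hq => hA ((hh q p).2 hq).le hp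
  have hup : ∀ {A : Finset P}, IsLowerSet (A : Set P) →
      ∀ p ∈ Aᶜ, ∀ q, h p < h q → q ∈ Aᶜ := by
    intro A hA p hp q hq
    rw [Finset.mem_compl] at hp ⊢
    exact fun hqA => hp (hlow hA q hqA p hq)
  refine ⟨?_, by rw [← hJ, ← hJ', hR, hX, hS], ?_⟩
  · rw [← compl_inj_iff, ← aboveLayer_botLayer h (hup hT.lower_left), hR,
      aboveLayer_botLayer h (hup hT'.lower_left)]
  · rw [← belowLayer_topLayer h (hlow hT.lower_right), hS,
      belowLayer_topLayer h (hlow hT'.lower_right)]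

end Layers

/-! ### Heights in a maximal ranked poset and the conclusion -/

theorem IsMaximalRanked.lt_iff_height_lt {P : Type*} [Fintype P] [PartialOrder P]
    (hP : IsMaximalRanked P) (p q : P) : p < q ↔ Order.height p < Order.height q := by
  constructor
  · intro hpq
    -- Strict monotonicity needs a finite height, which the cardinality of `P` bounds.
    refine Order.height_strictMono hpq
      (lt_of_le_of_lt (b := (Fintype.card P : ℕ∞)) ?_ (ENat.natCast_lt_top _))
    exact Order.height_le fun s _ => by exact_mod_cast s.length_lt_card.le
  · intro hlt
    rcases hP.comparable p q hlt.ne with hle | hle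
    · exact lt_of_le_of_ne hle fun h => hlt.ne (h ▸ rfl)
    · exact absurd (Order.height_mono hle) hlt.not_ge

theorem mainTheorem1 (P : Type*) [Fintype P] [PartialOrder P] (hP : IsMaximalRanked P) :
    (triangularTwoFaces (orderPolytope P)).Finite ∧
    (triangularTwoFaces (chainPolytope P)).Finite ∧
    (triangularTwoFaces (orderPolytope P)).ncard ≤
      (triangularTwoFaces (chainPolytope P)).ncard := by
  classical
  refine ⟨finite_triangularTwoFaces_orderPolytope, finite_triangularTwoFaces_chainPolytope, ?_⟩
  have hh := hP.lt_iff_height_lt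
  choose! I J K hT hF using fun F (hF : F ∈ triangularTwoFaces (orderPolytope P)) =>
    exists_isLowerTriple_of_mem_triangularTwoFaces hh hF
  refine ncard_le_ncard_of_injOn (fun F => convexHull ℝ (charVec '' {botLayer Order.height (I F)ᶜ,
    midLayer Order.height (I F) (J F) (K F), topLayer Order.height (K F)}))
    (fun F hF' => ((hT F hF').midLayer_spec hh).1.convexHull_mem hh) ?_
    finite_triangularTwoFaces_chainPolytope
  intro F hF₁ F' hF₂ heq
  obtain ⟨h1, h2, h3⟩ := (hT F hF₁).eq_of_convexHull_eq hh (hT F' hF₂) heq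
  rw [hF F hF₁, hF F' hF₂, h1, h2, h3]
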